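/- A (left) brace $(A,+,\circ)$ is a set with an abelian group structure $(A,+)$ and a group structure $(A,\circ)$ such that $a\circ(b+c)+a=a\circ b+a\circ c$ for all $a,b,c\in A$; write $a*b=a\circ b-a-b$. An additive subgroup $I$ of $A$ is an ideal if $i*a\in I$ and $a*i\in I$ for all $i\in I$, $a\in A$. For a prime $p$ and $i\ge 0$ put $p^iA=\{p^ia: a\in A\}$ and $\mathrm{ann}(p^i)=\{a\in A: p^ia=0\}$. An integer $\gamma$ is a primitive root modulo $m$ if every integer coprime to $m$ is congruent modulo $m$ to a power of $\gamma$. A pre-Lie ring $(L,+,\cdot)$ is an abelian group $(L,+)$ with a biadditive operation $\cdot$ such that $(x\cdot y)\cdot z-x\cdot(y\cdot z)=(y\cdot x)\cdot z-y\cdot(x\cdot z)$ for all $x,y,z\in L$. Theorem. Let $(A,+,\circ)$ be a brace of cardinality $p^n$, where $p$ is a prime and $n\geq 1$, and let $k$ be a natural number such that $p^{k(p-1)}A=0$. Assume that $p^iA$ and $\mathrm{ann}(p^i)$ are ideals of $A$ for every $i\ge 0$, and that $a*b\in\mathrm{ann}(p^k)$ for all $a\in p^kA$ and $b\in\mathrm{ann}(p^{2k})$.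 Let $\wp^{-1}:p^kA\to A$ be any function with $p^k\,\wp^{-1}(a)=a$ for all $a\in p^kA$. For $x\in A$ let $[x]$ denote the coset of $x$ in the additive group $A/\mathrm{ann}(p^{2k})$. Then $$[x]\odot[y]=[\wp^{-1}((p^kx)*y)]\qquad(x,y\in A)$$ is a well-defined binary operation on $A/\mathrm{ann}(p^{2k})$. Moreover, let $\gamma$ be a primitive root modulo $p^n$ and let $\xi=\gamma^{p^{n-1}}$. Then $$[x]\bullet[y]=\sum_{i=0}^{p-2}\xi^{p-1-i}\,[\xi^ix]\odot[y]\qquad(x,y\in A)$$ is a well-defined binary operation on $A/\mathrm{ann}(p^{2k})$, and $A/\mathrm{ann}(p^{2k})$ with its addition and $\bullet$ is a pre-Lie ring. -/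

import Mathlib

/-- A (left) brace: an abelian group `(A, +)` and a group `(A, ∘)` on the same set such that
`a ∘ (b + c) + a = a ∘ b + a ∘ c`. The operation `∘` is written as the multiplication `*` of the
`Group` structure. -/
class LeftBrace (A : Type*) extends AddCommGroup A, Group A where
  mul_add_add_self : ∀ a b c : A, a * (b + c) + a = a * b + a * c

namespace LeftBrace

variable {A : Type*} [LeftBrace A]

/-- The derived operation of a brace, `a ∗ b = a ∘ b - a - b`. -/
def ast (a b : A) : A := a * b - a - b

/-- An additive subgroup `I` of a brace is an ideal if `i ∗ a` and `a ∗ i` lie in `I` for all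
`i ∈ I` and all `a`. -/
def IsIdeal (I : AddSubgroup A) : Prop :=
  ∀ i ∈ I, ∀ a : A, ast i a ∈ I ∧ ast a i ∈ I

variable (A)

/-- `p ^ i A = {p ^ i a : a ∈ A}`. -/
def pMultiples (p i : ℕ) : AddSubgroup A := (nsmulAddMonoidHom (α := A) (p ^ i)).range

/-- `ann(p ^ i) = {a ∈ A : p ^ i a = 0}`. -/
def ann (p i : ℕ) : AddSubgroup A := (nsmulAddMonoidHom (α := A) (p ^ i)).ker

end LeftBrace

/-- `γ` is a primitive root modulo `m`: every integer coprime to `m` is congruent to a power of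
`γ` modulo `m`. -/
def IsPrimitiveRootModulo (γ : ℤ) (m : ℕ) : Prop :=
  ∀ a : ℤ, IsCoprime a (m : ℤ) → ∃ j : ℕ, a ≡ γ ^ j [ZMOD (m : ℤ)]

/-- The given abelian group `M` with the binary operation `mul` is a (left) pre-Lie ring: `mul` is
the multiplication of a `LeftPreLieRing` structure whose additive group is the given one. -/
def IsPreLieRing {M : Type*} [inst : AddCommGroup M] (mul : M → M → M) : Prop :=
  ∃ R : LeftPreLieRing M, R.toNonUnitalNonAssocRing.toAddCommGroup = inst ∧
    ∀ x y : M, R.toNonUnitalNonAssocRing.toMul.mul x y = mul x y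

/-! ### The operators `astHom a` and powers in the circle group -/

namespace LeftBrace

variable {A : Type*} [LeftBrace A]

/-! Write L_a for `astHom a`. The maps 1 + L_a compose like the circle group: (1 + L_a)(1 + L_b) = 1
+ L_c with c = a + b + L_a(b). Suppose that a ↦ L_a were polynomial with linear part ℓ. Then ℓ would
be additive, and the part of bidegree (1,1) of this identity would read ℓ_a ℓ_b = S(a,b) +
ℓ_{ℓ_a(b)} with S symmetric. So ℓ_{ℓ_a(b)} - ℓ_a ℓ_b would be symmetric in a and b, which is the
pre-Lie identity.

On p^k A this is what happens (`astHom_comp_mem_polyMaps`). Circle powers are binomial sums in the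
nilpotent operator L_c, and a sum of monomials can be rewritten as a circle product of circle
powers. Coefficients of degree d land in p^(kd) A, so degrees ≥ p - 1 vanish and only factorials
prime to p are inverted. Since ξ is a root of unity of order p - 1 modulo p^n, the twisted sum over
its powers kills every surviving degree except 1. It yields `linHom`, a multiple of ℓ, with
`linHom_add` and `linHom_mul_linHom`.

Finally, multiplication by p^(2k) embeds A/ann(p^(2k)) in A and sends [x] • [y] to p^k `linHom` (p^k
x) y. The hypothesis on `ast` makes this well defined and lets powers of p be cancelled inside
products (`nsmul_ast_congr`, `linHom_congr`). -/

theorem mul_zero_eq (a : A) : a * 0 = a := by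
  have h := mul_add_add_self a 0 0
  rw [add_zero] at h
  exact (add_left_cancel h).symm

theorem one_eq_zero : (1 : A) = 0 := by
  rw [← mul_zero_eq (1 : A), one_mul]

theorem ast_add (a b c : A) : ast a (b + c) = ast a b + ast a c := by
  have h := mul_add_add_self a b c
  have h' : a * (b + c) = a * b + a * c - a := by rw [← h]; abel
  simp only [ast, h']
  abel

/-- The additive endomorphism `b ↦ a ∗ b`. -/
def astHom (a : A) : AddMonoid.End A := AddMonoidHom.mk' (ast a) (ast_add a)

theorem astHom_apply (a b : A) : astHom a b = ast a b := rfl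

theorem mul_eq (a b : A) : a * b = a + b + astHom a b := by
  simp only [astHom_apply, ast]
  abel

/-- Associativity of the circle product, expanded: 1 + L is multiplicative. -/
theorem astHom_mul (a b : A) :
    astHom (a * b) = astHom a + astHom b + astHom a * astHom b := by
  ext c
  have h1 := mul_eq (a * b) c
  rw [mul_assoc, mul_eq b c, mul_eq a (b + c + astHom b c), map_add, map_add, mul_eq a b] at h1
  change astHom (a * b) c = astHom a c + astHom b c + astHom a (astHom b c)
  rw [mul_eq a b, ← sub_eq_zero]
  rw [← sub_eq_zero] at h1
  rw [← neg_eq_zero, ← h1]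
  abel

theorem astHom_zero : astHom (0 : A) = 0 := by
  ext c
  have h1 := mul_eq (0 : A) c
  rw [← one_eq_zero, one_mul, one_eq_zero, zero_add] at h1
  simpa using h1.symm

theorem inv_add_self (b : A) : b⁻¹ + b + astHom b⁻¹ b = 0 := by
  rw [← mul_eq, inv_mul_cancel, one_eq_zero]

/-- Division on the left by `b` in the circle group, in terms of `∗`. -/
theorem inv_mul_eq (b y : A) : b⁻¹ * y = (y - b) + astHom b⁻¹ (y - b) := by
  rw [mul_eq, map_sub, ← sub_eq_zero, ← inv_add_self b]
  abel

/-- `∑_{j < J} (N choose j + 1) x ^ j`, which is `((1 + x) ^ N - 1) / x` if `x ^ J = 0`. -/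
def binomSum {R : Type*} [Ring R] (J : ℕ) (x : R) (N : ℕ) : R :=
  ∑ j ∈ Finset.range J, N.choose (j + 1) • x ^ j

/-- Pascal's rule; nilpotency removes the one term beyond the truncation. -/
theorem binomSum_succ {R : Type*} [Ring R] (J : ℕ) (x : R) (hx : x ^ J = 0) (N : ℕ) :
    binomSum J x (N + 1) = 1 + binomSum J x N + x * binomSum J x N := by
  have h1 : x * binomSum J x N = ∑ j ∈ Finset.range J, N.choose (j + 1) • x ^ (j + 1) := by
    simp only [binomSum, Finset.mul_sum, mul_smul_comm, pow_succ']
  have h2 : 1 + x * binomSum J x N = ∑ j ∈ Finset.range J, N.choose j • x ^ j := by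
    have h3 := Finset.sum_range_succ' (fun j => N.choose j • x ^ j) J
    rw [Finset.sum_range_succ, hx, smul_zero, add_zero] at h3
    rw [h1, h3]
    simp [add_comm]
  rw [add_right_comm, h2]
  simp only [binomSum, ← Finset.sum_add_distrib, Nat.choose_succ_succ, add_smul]

theorem pow_eq_binomSum {J : ℕ} {a : A} (ha : astHom a ^ J = 0) (N : ℕ) :
    a ^ N = binomSum J (astHom a) N a := by
  induction N with
  | zero => simp [binomSum, one_eq_zero]
  | succ N ih =>
    rw [pow_succ', mul_eq, ih, binomSum_succ J _ ha]
    rfl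

theorem astHom_pow {J : ℕ} {a : A} (ha : astHom a ^ J = 0) (N : ℕ) :
    astHom (a ^ N) = binomSum J (astHom a) N * astHom a := by
  induction N with
  | zero => simp [binomSum, one_eq_zero, astHom_zero]
  | succ N ih =>
    rw [pow_succ', astHom_mul, ih, binomSum_succ J _ ha]
    noncomm_ring

/-! ### The filtrations by the subgroups `p ^ (k j) A` -/

variable (A)

/-- The endomorphisms of `A` with values in `p ^ i A`. -/
def endMultiples (p i : ℕ) : AddSubgroup (AddMonoid.End A) where
  carrier := {φ | ∀ x, φ x ∈ pMultiples A p i}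
  zero_mem' _ := zero_mem _
  add_mem' h h' x := add_mem (h x) (h' x)
  neg_mem' h x := neg_mem (h x)

variable {A}

theorem mem_ann {p i : ℕ} {a : A} : a ∈ ann A p i ↔ p ^ i • a = 0 := Iff.rfl

theorem pMultiples_antitone (p : ℕ) : Antitone (pMultiples A p) := by
  rintro i j hij _ ⟨x, rfl⟩
  refine ⟨p ^ (j - i) • x, ?_⟩
  change p ^ i • p ^ (j - i) • x = p ^ j • x
  rw [smul_smul, ← pow_add, Nat.add_sub_cancel' hij]

theorem endMultiples_antitone (p : ℕ) : Antitone (endMultiples A p) :=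
  fun _ _ hij _ hφ x => pMultiples_antitone p hij (hφ x)

theorem apply_mem_pMultiples {p i j : ℕ} {φ : AddMonoid.End A} (hφ : φ ∈ endMultiples A p i)
    {a : A} (ha : a ∈ pMultiples A p j) : φ a ∈ pMultiples A p (i + j) := by
  obtain ⟨x, rfl⟩ := ha
  obtain ⟨y, hy⟩ := hφ x
  refine ⟨y, ?_⟩
  change p ^ (i + j) • y = φ (p ^ j • x)
  change p ^ i • y = φ x at hy
  rw [map_nsmul, ← hy, smul_smul, pow_add, mul_comm]

theorem mul_mem_endMultiples {p i j : ℕ} {φ ψ : AddMonoid.End A} (hφ : φ ∈ endMultiples A p i)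
    (hψ : ψ ∈ endMultiples A p j) : φ * ψ ∈ endMultiples A p (i + j) :=
  fun x => apply_mem_pMultiples hφ (hψ x)

theorem pow_mem_endMultiples {p i : ℕ} {φ : AddMonoid.End A} (hφ : φ ∈ endMultiples A p i)
    (j : ℕ) : φ ^ j ∈ endMultiples A p (j * i) := by
  induction j with
  | zero => exact fun x => ⟨x, by simp⟩
  | succ j ih => rw [pow_succ, add_mul, one_mul]; exact mul_mem_endMultiples ih hφ

theorem astHom_mem {p i : ℕ} (hpow : IsIdeal (pMultiples A p i)) {a : A}
    (ha : a ∈ pMultiples A p i) : astHom a ∈ endMultiples A p i :=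
  fun x => (hpow a ha x).1

theorem inv_mem_of_isIdeal {I : AddSubgroup A} (hI : IsIdeal I) {a : A} (ha : a ∈ I) :
    a⁻¹ ∈ I := by
  have h : a⁻¹ = -(a + astHom a⁻¹ a) := by
    rw [eq_neg_iff_add_eq_zero, ← add_assoc]
    exact inv_add_self a
  rw [h]
  exact neg_mem (add_mem ha (hI a ha _).2)

end LeftBrace

/-! ### Polynomial maps with filtered coefficients -/

namespace LeftBrace

section PolyMaps

variable {ι : Type*} [Fintype ι] {M N K : Type*} [AddCommGroup M] [AddCommGroup N]
  [AddCommGroup K]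

/-- The maps `(ι → ℕ) → M` spanned by the monomials `t ↦ t ^ β • c` whose coefficient `c` lies in
the step `max |β| w` of a filtration of `M`. -/
def polyMaps (ι : Type*) [Fintype ι] (F : ℕ → AddSubgroup M) (w : ℕ) :
    AddSubgroup ((ι → ℕ) → M) :=
  AddSubgroup.closure {f | ∃ β : ι → ℕ, ∃ c ∈ F (max (∑ i, β i) w),
    f = fun t => (∏ i, t i ^ β i) • c}

theorem monomial_mem_polyMaps {F : ℕ → AddSubgroup M} {w : ℕ} (β : ι → ℕ) {c : M}
    (hc : c ∈ F (max (∑ i, β i) w)) : (fun t => (∏ i, t i ^ β i) • c) ∈ polyMaps ι F w :=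
  AddSubgroup.subset_closure ⟨β, c, hc, rfl⟩

theorem coord_mem_polyMaps {F : ℕ → AddSubgroup M} [DecidableEq ι] (i : ι) {c : M}
    (hc : c ∈ F 1) : (fun t => t i • c) ∈ polyMaps ι F 1 := by
  have h := monomial_mem_polyMaps (F := F) (w := 1) (Pi.single i 1) (c := c) (by simpa using hc)
  convert h using 3 with t
  rw [Finset.prod_eq_single i] <;> simp +contextual

theorem sum_mem_polyMaps {F : ℕ → AddSubgroup M} {w : ℕ} {κ : Type*} (s : Finset κ)
    {f : κ → (ι → ℕ) → M} (hf : ∀ j ∈ s, f j ∈ polyMaps ι F w) :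
    (fun t => ∑ j ∈ s, f j t) ∈ polyMaps ι F w := by
  simpa only [← Finset.sum_apply] using sum_mem hf

theorem polyMaps_antitone {F : ℕ → AddSubgroup M} (hF : Antitone F) :
    Antitone (polyMaps ι F) := by
  intro v w hvw
  refine AddSubgroup.closure_mono ?_
  rintro f ⟨β, c, hc, rfl⟩
  exact ⟨β, c, hF (max_le_max_left _ hvw) hc, rfl⟩

/-- Degrees add and max |β| v + max |β'| w dominates both |β + β'| and v + w. -/
theorem bilin_mem_polyMaps {F : ℕ → AddSubgroup M} {G : ℕ → AddSubgroup N}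
    {H : ℕ → AddSubgroup K} (hH : Antitone H) (B : M →+ N →+ K)
    (hB : ∀ i j, ∀ x ∈ F i, ∀ y ∈ G j, B x y ∈ H (i + j)) {v w : ℕ} {f : (ι → ℕ) → M}
    {g : (ι → ℕ) → N} (hf : f ∈ polyMaps ι F v) (hg : g ∈ polyMaps ι G w) :
    (fun t => B (f t) (g t)) ∈ polyMaps ι H (v + w) := by
  induction hf using AddSubgroup.closure_induction with
  | mem f hf =>
    obtain ⟨β, c, hc, rfl⟩ := hf
    induction hg using AddSubgroup.closure_induction with
    | mem g hg =>
      obtain ⟨β', c', hc', rfl⟩ := hg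
      have h := monomial_mem_polyMaps (F := H) (w := v + w) (β + β') (c := B c c')
        (hH (by simp only [Pi.add_apply, Finset.sum_add_distrib]; omega) (hB _ _ c hc c' hc'))
      convert h using 2 with t
      simp only [map_nsmul, AddMonoidHom.nsmul_apply, Pi.add_apply, pow_add,
        Finset.prod_mul_distrib, mul_smul]
      exact smul_comm _ _ _
    | zero =>
      simp only [Pi.zero_apply, map_zero]
      exact zero_mem _
    | add g g' _ _ h1 h2 =>
      simp only [Pi.add_apply, map_add]
      exact add_mem h1 h2
    | neg g _ h1 =>
      simp only [Pi.neg_apply, map_neg]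
      exact neg_mem h1
  | zero =>
    simp only [Pi.zero_apply, map_zero, AddMonoidHom.zero_apply]
    exact zero_mem _
  | add f f' _ _ h1 h2 =>
    simp only [Pi.add_apply, map_add, AddMonoidHom.add_apply]
    exact add_mem h1 h2
  | neg f _ h1 =>
    simp only [Pi.neg_apply, map_neg, AddMonoidHom.neg_apply]
    exact neg_mem h1

theorem polyMaps_eq_bot {F : ℕ → AddSubgroup M} {w : ℕ} (hF : ∀ j, w ≤ j → F j = ⊥) :
    polyMaps ι F w = ⊥ := by
  rw [polyMaps, AddSubgroup.closure_eq_bot_iff]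
  rintro f ⟨β, c, hc, rfl⟩
  rw [hF _ (le_max_right _ _), AddSubgroup.mem_bot] at hc
  subst hc
  simp only [smul_zero]
  rfl

/-- Binomial coefficients `(N choose j)` with `j < p` are polynomials in `N` on a module killed
by a power of `p`. -/
theorem choose_mem_polyMaps {F : ℕ → AddSubgroup M} (hF : Antitone F) {p n : ℕ} (hp : p.Prime)
    (hM : ∀ x : M, p ^ n • x = 0) {w j : ℕ} (hj : j < p) (β : ι → ℕ) {c : M}
    (hc : c ∈ F (max (j * ∑ i, β i) w)) :
    (fun t => (∏ i, t i ^ β i).choose j • c) ∈ polyMaps ι F w := by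
  have hcop : IsCoprime ((j.factorial : ℕ) : ℤ) ((p ^ n : ℕ) : ℤ) := by
    rw [Nat.isCoprime_iff_coprime]
    exact Nat.Coprime.pow_right _ (hp.coprime_factorial_of_lt hj).symm
  -- u inverts j! modulo p^n, so c = j! (u c), and j! (T choose j) is a falling factorial with
  -- integer coefficients in T.
  obtain ⟨u, v, huv⟩ := hcop
  have huc : (j.factorial : ℤ) • (u • c) = c := by
    have h : (u * (j.factorial : ℤ) + v * ((p ^ n : ℕ) : ℤ)) • c = c := by rw [huv, one_smul]
    rw [add_smul, mul_smul v, natCast_zsmul _ (p ^ n), hM, smul_zero, add_zero] at h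
    rwa [smul_smul, mul_comm]
  have key : (fun t : ι → ℕ => (∏ i, t i ^ β i).choose j • c) =
      ∑ m ∈ Finset.range (j + 1), fun t : ι → ℕ => (∏ i, t i ^ (m • β) i) •
        ((descPochhammer ℤ j).coeff m • (u • c)) := by
    funext t
    set T := ∏ i, t i ^ β i with hT
    have h1 : ∀ m, ∏ i, t i ^ (m • β) i = T ^ m := by
      intro m
      rw [hT, ← Finset.prod_pow]
      refine Finset.prod_congr rfl fun i _ => ?_
      rw [← pow_mul, Pi.smul_apply, smul_eq_mul, mul_comm]
    have h2 : ((T.choose j * j.factorial : ℕ) : ℤ) =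
        ∑ m ∈ Finset.range (j + 1), (descPochhammer ℤ j).coeff m * (T : ℤ) ^ m := by
      rw [mul_comm, ← Nat.descFactorial_eq_factorial_mul_choose,
        ← descPochhammer_eval_eq_descFactorial ℤ, Polynomial.eval_eq_sum_range,
        descPochhammer_natDegree]
    rw [Finset.sum_apply]
    simp only [h1]
    calc T.choose j • c = ((T.choose j * j.factorial : ℕ) : ℤ) • (u • c) := by
          rw [Nat.cast_mul, mul_smul, huc, natCast_zsmul]
      _ = _ := by
          rw [h2, Finset.sum_smul]
          refine Finset.sum_congr rfl fun m _ => ?_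
          rw [mul_comm, mul_smul, ← Nat.cast_pow, natCast_zsmul]
  rw [key]
  refine sum_mem fun m hm => monomial_mem_polyMaps _ ?_
  refine zsmul_mem (zsmul_mem (hF ?_ hc) _) _
  simp only [Pi.smul_apply, smul_eq_mul, ← Finset.mul_sum]
  exact max_le_max_right _ (Nat.mul_le_mul_right _ (by simpa [Nat.lt_succ_iff] using hm))

end PolyMaps

end LeftBrace

/-! ### Polynomiality of `astHom` on p^k A -/

namespace LeftBrace

variable {A : Type*} [LeftBrace A] {ι : Type*} [Fintype ι]

theorem pMultiples_mul_antitone (p k : ℕ) : Antitone fun j => pMultiples A p (k * j) :=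
  fun _ _ h => pMultiples_antitone p (Nat.mul_le_mul_left k h)

theorem endMultiples_mul_antitone (p k : ℕ) : Antitone fun j => endMultiples A p (k * j) :=
  fun _ _ h => endMultiples_antitone p (Nat.mul_le_mul_left k h)

/-- Evaluation of endomorphisms at `c`. -/
def evalEnd (c : A) : AddMonoid.End A →+ A := AddMonoidHom.mk' (fun φ => φ c) fun _ _ => rfl

theorem evalEnd_apply (c : A) (φ : AddMonoid.End A) : evalEnd c φ = φ c := rfl

theorem apply_mem_polyMaps {p k v w : ℕ} {φ : (ι → ℕ) → AddMonoid.End A} {g : (ι → ℕ) → A}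
    (hφ : φ ∈ polyMaps ι (fun j => endMultiples A p (k * j)) v)
    (hg : g ∈ polyMaps ι (fun j => pMultiples A p (k * j)) w) :
    (fun t => φ t (g t)) ∈ polyMaps ι (fun j => pMultiples A p (k * j)) (v + w) :=
  bilin_mem_polyMaps (pMultiples_mul_antitone p k)
    (AddMonoidHom.mk' (fun φ : AddMonoid.End A => (φ : A →+ A)) fun _ _ => rfl)
    (fun i j x hx y hy => by
      have h := apply_mem_pMultiples hx hy
      rwa [← mul_add] at h) hφ hg

theorem mul_mem_polyMaps {p k v w : ℕ} {φ ψ : (ι → ℕ) → AddMonoid.End A}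
    (hφ : φ ∈ polyMaps ι (fun j => endMultiples A p (k * j)) v)
    (hψ : ψ ∈ polyMaps ι (fun j => endMultiples A p (k * j)) w) :
    (fun t => φ t * ψ t) ∈ polyMaps ι (fun j => endMultiples A p (k * j)) (v + w) :=
  bilin_mem_polyMaps (endMultiples_mul_antitone p k) AddMonoidHom.mul
    (fun i j x hx y hy => by
      have h := mul_mem_endMultiples hx hy
      rwa [← mul_add] at h) hφ hψ

theorem endMultiples_eq_bot {p i : ℕ} (h : pMultiples A p i = ⊥) : endMultiples A p i = ⊥ := by
  refine (AddSubgroup.eq_bot_iff_forall _).2 fun φ hφ => ?_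
  ext x
  have hx := hφ x
  rw [h] at hx
  exact hx

theorem astHom_pow_eq_zero {p k : ℕ} (hk : pMultiples A p (k * (p - 1)) = ⊥)
    (hpow : IsIdeal (pMultiples A p k)) {a : A} (ha : a ∈ pMultiples A p k) :
    astHom a ^ (p - 1) = 0 := by
  have h := pow_mem_endMultiples (astHom_mem hpow ha) (p - 1)
  rwa [mul_comm, endMultiples_eq_bot hk] at h

theorem astHom_pow_monomial_mem {p n k w : ℕ} (hp : p.Prime) (hA : ∀ x : A, p ^ n • x = 0)
    (hk : pMultiples A p (k * (p - 1)) = ⊥) (hpow : ∀ i, IsIdeal (pMultiples A p i)) (hw : 1 ≤ w)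
    (β : ι → ℕ) {c : A} (hc : c ∈ pMultiples A p (k * max (∑ i, β i) w)) :
    (fun t : ι → ℕ => astHom (c ^ ∏ i, t i ^ β i)) ∈
      polyMaps ι (fun j => endMultiples A p (k * j)) w := by
  have hc1 : c ∈ pMultiples A p k :=
    pMultiples_antitone p (Nat.le_mul_of_pos_right k (by omega)) hc
  simp only [astHom_pow (astHom_pow_eq_zero hk (hpow k) hc1), binomSum, Finset.sum_mul,
    smul_mul_assoc, ← pow_succ]
  refine sum_mem_polyMaps _ fun j hj => ?_
  refine choose_mem_polyMaps (endMultiples_mul_antitone p k) hp (n := n)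
    (fun φ => by ext x; exact hA (φ x)) (by have := Finset.mem_range.1 hj; omega) β ?_
  refine endMultiples_antitone p ?_ (pow_mem_endMultiples (astHom_mem (hpow _) hc) (j + 1))
  rw [mul_left_comm]
  refine Nat.mul_le_mul_left k (max_le (Nat.mul_le_mul_left _ (le_max_left _ _)) ?_)
  exact (le_max_right _ _).trans (Nat.le_mul_of_pos_left _ (by omega))

/-- The binomial terms beyond the first involve at least two factors from c, so they gain a step of
the filtration because w ≥ 1. -/
theorem pow_monomial_sub_mem {p n k w : ℕ} (hp : p.Prime) (hA : ∀ x : A, p ^ n • x = 0)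
    (hk : pMultiples A p (k * (p - 1)) = ⊥) (hpow : ∀ i, IsIdeal (pMultiples A p i)) (hw : 1 ≤ w)
    (β : ι → ℕ) {c : A} (hc : c ∈ pMultiples A p (k * max (∑ i, β i) w)) :
    (fun t : ι → ℕ => c ^ (∏ i, t i ^ β i) - (∏ i, t i ^ β i) • c) ∈
      polyMaps ι (fun j => pMultiples A p (k * j)) (w + 1) := by
  have hc1 : c ∈ pMultiples A p k :=
    pMultiples_antitone p (Nat.le_mul_of_pos_right k (by omega)) hc
  have hp2 := hp.two_le
  have key : ∀ N : ℕ, c ^ N - N • c =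
      ∑ j ∈ Finset.range (p - 2), N.choose (j + 2) • (astHom c ^ (j + 1)) c := by
    intro N
    rw [pow_eq_binomSum (astHom_pow_eq_zero hk (hpow k) hc1), binomSum,
      show p - 1 = (p - 2) + 1 by omega, Finset.sum_range_succ', ← evalEnd_apply c, map_add,
      map_sum]
    simp [evalEnd_apply]
  simp only [key]
  refine sum_mem_polyMaps _ fun j hj => ?_
  refine choose_mem_polyMaps (pMultiples_mul_antitone p k) hp hA
    (by have := Finset.mem_range.1 hj; omega) β ?_
  refine pMultiples_antitone p ?_
    (apply_mem_pMultiples (pow_mem_endMultiples (astHom_mem (hpow _) hc) (j + 1)) hc)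
  rw [mul_left_comm, ← mul_add]
  refine Nat.mul_le_mul_left k ?_
  set S := ∑ i, β i
  rw [← Nat.succ_mul]
  refine max_le (Nat.mul_le_mul_left _ (le_max_left _ _)) ?_
  calc w + 1 ≤ (j + 2) * w := by nlinarith
    _ ≤ _ := Nat.mul_le_mul_left _ (le_max_right _ _)

/-- If `g` is a polynomial map into `p ^ k A` then so is `t ↦ astHom (g t)`. -/
theorem astHom_comp_mem_polyMaps {p n k : ℕ} (hp : p.Prime) (hA : ∀ x : A, p ^ n • x = 0)
    (hk : pMultiples A p (k * (p - 1)) = ⊥) (hpow : ∀ i, IsIdeal (pMultiples A p i)) {w : ℕ}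
    (hw : 1 ≤ w) {g : (ι → ℕ) → A} (hg : g ∈ polyMaps ι (fun j => pMultiples A p (k * j)) w) :
    (fun t => astHom (g t)) ∈ polyMaps ι (fun j => endMultiples A p (k * j)) w := by
  -- Downward induction on w; d bounds the distance to weight p - 1, where all coefficients vanish.
  obtain ⟨d, hd⟩ : ∃ d, p - 1 ≤ w + d := ⟨p - 1, Nat.le_add_left _ _⟩
  induction d generalizing w g with
  | zero =>
    have hbot : polyMaps ι (fun j => pMultiples A p (k * j)) w = ⊥ := polyMaps_eq_bot
      fun j hj => eq_bot_iff.2 (hk ▸ pMultiples_mul_antitone p k (by omega))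
    rw [hbot, AddSubgroup.mem_bot] at hg
    subst hg
    simp only [Pi.zero_apply, astHom_zero]
    exact zero_mem _
  | succ d ih =>
    have anti := polyMaps_antitone (ι := ι) (pMultiples_mul_antitone (A := A) p k)
    have antiE := polyMaps_antitone (ι := ι) (endMultiples_mul_antitone (A := A) p k)
    -- Splitting off a monomial creates errors of weight w + 1, so the inner induction must allow an
    -- arbitrary such h.
    suffices H : ∀ h ∈ polyMaps ι (fun j => pMultiples A p (k * j)) (w + 1),
        (fun t => astHom ((g + h) t)) ∈ polyMaps ι (fun j => endMultiples A p (k * j)) w by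
      simpa using H 0 (zero_mem _)
    have step : ∀ (β : ι → ℕ) (c : A), c ∈ pMultiples A p (k * max (∑ i, β i) w) →
        ∀ g ∈ polyMaps ι (fun j => pMultiples A p (k * j)) w,
        (∀ h ∈ polyMaps ι (fun j => pMultiples A p (k * j)) (w + 1),
          (fun t => astHom ((g + h) t)) ∈ polyMaps ι (fun j => endMultiples A p (k * j)) w) →
        ∀ h ∈ polyMaps ι (fun j => pMultiples A p (k * j)) (w + 1),
          (fun t => astHom (((fun t : ι → ℕ => (∏ i, t i ^ β i) • c) + g + h) t)) ∈
            polyMaps ι (fun j => endMultiples A p (k * j)) w := by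
      intro β c hc g hg ihg h hh
      set m : (ι → ℕ) → A := fun t => (∏ i, t i ^ β i) • c with hm
      set b : (ι → ℕ) → A := fun t => c ^ (∏ i, t i ^ β i) with hb
      have hbm : b - m ∈ polyMaps ι (fun j => pMultiples A p (k * j)) (w + 1) :=
        pow_monomial_sub_mem hp hA hk hpow hw β hc
      have hLb : (fun t => astHom (b t)) ∈ polyMaps ι (fun j => endMultiples A p (k * j)) w :=
        astHom_pow_monomial_mem hp hA hk hpow hw β hc
      have hLb' : (fun t => astHom (b t)⁻¹) ∈
          polyMaps ι (fun j => endMultiples A p (k * j)) w := by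
        have := astHom_pow_monomial_mem hp hA hk hpow hw β (inv_mem_of_isIdeal (hpow _) hc)
        simpa only [inv_pow] using this
      set r : (ι → ℕ) → A := h - (b - m) with hr
      have hrm : r ∈ polyMaps ι (fun j => pMultiples A p (k * j)) (w + 1) := sub_mem hh hbm
      -- Chosen so that m + g + h = b ∘ (g + e): dividing by b on the left leaves g plus terms of
      -- higher weight.
      set e : (ι → ℕ) → A := r + fun t => astHom (b t)⁻¹ ((g + r) t) with he
      have hem : e ∈ polyMaps ι (fun j => pMultiples A p (k * j)) (w + 1) :=
        add_mem hrm (anti (by omega)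
          (apply_mem_polyMaps hLb' (add_mem hg (anti (Nat.le_succ w) hrm))))
      have hx := ihg e hem
      have hfac : ∀ t, (m + g + h) t = b t * (g + e) t := by
        intro t
        rw [← inv_mul_eq_iff_eq_mul, inv_mul_eq]
        have : (m + g + h) t - b t = (g + r) t := by
          simp only [hr, Pi.add_apply, Pi.sub_apply]; abel
        rw [this]
        simp only [he, Pi.add_apply]
        abel
      simp only [hfac, astHom_mul]
      exact add_mem (add_mem hLb hx) (antiE (by omega) (mul_mem_polyMaps hLb hx))
    induction hg using AddSubgroup.closure_induction_left with
    | zero =>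
      intro h hh
      simp only [zero_add]
      exact antiE (Nat.le_succ w) (ih (by omega) hh (by omega))
    | add_left m hm g hg ihg =>
      obtain ⟨β, c, hc, rfl⟩ := hm
      exact step β c hc g hg ihg
    | neg_add_cancel m hm g hg ihg =>
      obtain ⟨β, c, hc, rfl⟩ := hm
      have := step β (-c) (neg_mem hc) g hg ihg
      simp only [smul_neg] at this
      exact this

end LeftBrace

/-! ### Extracting linear parts by averaging over roots of unity -/

namespace LeftBrace

section Average

variable {M N : Type*} [AddCommGroup M] [AddCommGroup N]

/-- The twisted average `∑_{r < p - 1} ζ ^ (p - 1 - r) h (ζ ^ r)`. If `ζ` is a primitive root of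
unity of order `p - 1`, it extracts `p - 1` times the linear part of `h`. -/
def twistedAvg (p ζ : ℕ) (h : ℕ → M) : M :=
  ∑ r ∈ Finset.range (p - 1), ζ ^ (p - 1 - r) • h (ζ ^ r)

variable {p n ζ : ℕ}

theorem twistedAvg_add (f g : ℕ → M) : twistedAvg p ζ (fun s => f s + g s) =
    twistedAvg p ζ f + twistedAvg p ζ g := by
  simp only [twistedAvg, smul_add, Finset.sum_add_distrib]

theorem twistedAvg_neg (f : ℕ → M) : twistedAvg p ζ (fun s => -f s) = -twistedAvg p ζ f := by
  simp only [twistedAvg, smul_neg, Finset.sum_neg_distrib]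

theorem twistedAvg_zero : twistedAvg p ζ (fun _ => (0 : M)) = 0 := by
  simp only [twistedAvg, smul_zero, Finset.sum_const_zero]

theorem map_twistedAvg (φ : M →+ N) (f : ℕ → M) :
    φ (twistedAvg p ζ f) = twistedAvg p ζ (fun s => φ (f s)) := by
  simp only [twistedAvg, map_sum, map_nsmul]

theorem twistedAvg_comm (f : ℕ → ℕ → M) :
    twistedAvg p ζ (fun s => twistedAvg p ζ (fun t => f s t)) =
      twistedAvg p ζ (fun t => twistedAvg p ζ (fun s => f s t)) := by
  simp only [twistedAvg, Finset.smul_sum]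
  rw [Finset.sum_comm]
  refine Finset.sum_congr rfl fun r _ => Finset.sum_congr rfl fun q _ => smul_comm _ _ _

/-- `ζ` behaves like a primitive root of unity of order `p - 1` modulo `p ^ n`. -/
def KillsPowers (p n ζ : ℕ) : Prop :=
  ∀ m, m < p - 1 → m ≠ 1 → p ^ n ∣ ∑ r ∈ Finset.range (p - 1), ζ ^ (p - 1 - r) * (ζ ^ r) ^ m

theorem twistedAvg_pow (hζ : KillsPowers p n ζ) (hM : ∀ x : M, p ^ n • x = 0) {m : ℕ}
    (hm : m < p - 1) (hm1 : m ≠ 1) (c : M) : twistedAvg p ζ (fun s => s ^ m • c) = 0 := by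
  obtain ⟨u, hu⟩ := hζ m hm hm1
  simp only [twistedAvg, smul_smul, ← Finset.sum_smul]
  rw [hu, mul_comm, mul_smul, hM, smul_zero]

theorem twistedAvg_pow_pow (hζ : KillsPowers p n ζ) (hM : ∀ x : M, p ^ n • x = 0) {x y : ℕ}
    (hx : x < p - 1) (hy : y < p - 1) (hxy : x ≠ 1 ∨ y ≠ 1) (c : M) :
    twistedAvg p ζ (fun s => twistedAvg p ζ (fun t => (s ^ x * t ^ y) • c)) = 0 := by
  rcases hxy with h | h
  · rw [twistedAvg_comm]
    have : ∀ t, twistedAvg p ζ (fun s => (s ^ x * t ^ y) • c) = 0 := fun t => by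
      simp only [mul_smul]
      exact twistedAvg_pow hζ hM hx h _
    simp only [this, twistedAvg_zero]
  · have : ∀ s, twistedAvg p ζ (fun t => (s ^ x * t ^ y) • c) = 0 := fun s => by
      simp only [mul_smul, fun t : ℕ => smul_comm (s ^ x) (t ^ y) c]
      exact twistedAvg_pow hζ hM hy h _
    simp only [this, twistedAvg_zero]

variable {F : ℕ → AddSubgroup M}

/-- Only monomials of total degree 1 survive the average, and these involve a single variable. -/
theorem twistedAvg_diagonal (hF : Antitone F) (hbot : F (p - 1) = ⊥) (hζ : KillsPowers p n ζ)
    (hM : ∀ x : M, p ^ n • x = 0) {f : (Fin 2 → ℕ) → M} (hf : f ∈ polyMaps (Fin 2) F 1) :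
    twistedAvg p ζ (fun s => f ![s, s]) =
      twistedAvg p ζ (fun s => f ![s, 0]) + twistedAvg p ζ (fun s => f ![0, s]) := by
  induction hf using AddSubgroup.closure_induction with
  | zero => simp [twistedAvg_zero]
  | add f g _ _ h1 h2 =>
    simp only [Pi.add_apply, twistedAvg_add, h1, h2]
    abel
  | neg f _ h1 =>
    simp only [Pi.neg_apply, twistedAvg_neg, h1]
    abel
  | mem f hf =>
    obtain ⟨β, c, hc, rfl⟩ := hf
    simp only [Fin.prod_univ_two, Matrix.cons_val_zero, Matrix.cons_val_one, Fin.sum_univ_two]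
      at hc ⊢
    generalize β 0 = i at *
    generalize β 1 = j at *
    by_cases hij : i + j < p - 1
    swap
    · have hc0 := hF (show p - 1 ≤ max (i + j) 1 by omega) hc
      rw [hbot, AddSubgroup.mem_bot] at hc0
      simp [hc0, twistedAvg_zero]
    by_cases h1 : i + j = 1
    · obtain ⟨rfl, rfl⟩ | ⟨rfl, rfl⟩ : (i = 1 ∧ j = 0) ∨ (i = 0 ∧ j = 1) := by omega
      · simp [twistedAvg_zero]
      · simp [twistedAvg_zero]
    · have e : ∀ m, m = i + j → twistedAvg p ζ (fun s => s ^ m • c) = 0 :=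
        fun m hm => twistedAvg_pow hζ hM (by omega) (by omega) c
      rcases Nat.eq_zero_or_pos i with rfl | hi <;> rcases Nat.eq_zero_or_pos j with rfl | hj
      · simp [← e 0 rfl]
      · simp [hj.ne', e j (by simp), twistedAvg_zero]
      · simp [hi.ne', e i (by simp), twistedAvg_zero]
      · simp [hi.ne', hj.ne', ← pow_add, e (i + j), twistedAvg_zero]

/-- The survivors have degree 1 in s and in t. They are t₀t₁, t₂t₃, t₀t₃ and t₂t₁, each seen by
exactly one term on the right. -/
theorem twistedAvg_bidiagonal (hF : Antitone F) (hbot : F (p - 1) = ⊥) (hζ : KillsPowers p n ζ)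
    (hM : ∀ x : M, p ^ n • x = 0) {f : (Fin 4 → ℕ) → M} (hf : f ∈ polyMaps (Fin 4) F 1) :
    twistedAvg p ζ (fun s => twistedAvg p ζ (fun t => f ![s, t, s, t])) =
      twistedAvg p ζ (fun s => twistedAvg p ζ (fun t => f ![s, t, 0, 0])) +
      twistedAvg p ζ (fun s => twistedAvg p ζ (fun t => f ![0, 0, s, t])) +
      twistedAvg p ζ (fun s => twistedAvg p ζ (fun t => f ![s, 0, 0, t])) +
      twistedAvg p ζ (fun s => twistedAvg p ζ (fun t => f ![0, t, s, 0])) := by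
  induction hf using AddSubgroup.closure_induction with
  | zero => simp [twistedAvg_zero]
  | add f g _ _ h1 h2 =>
    simp only [Pi.add_apply, twistedAvg_add, h1, h2]
    abel
  | neg f _ h1 =>
    simp only [Pi.neg_apply, twistedAvg_neg, h1]
    abel
  | mem f hf =>
    obtain ⟨β, c, hc, rfl⟩ := hf
    simp only [Fin.prod_univ_four, Matrix.cons_val_zero, Matrix.cons_val_one, Fin.sum_univ_four,
      Matrix.cons_val] at hc ⊢
    generalize β 0 = i at *
    generalize β 1 = j at *
    generalize β 2 = l at *
    generalize β 3 = m at *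
    by_cases hij : i + j + l + m < p - 1
    swap
    · have hc0 := hF (show p - 1 ≤ max (i + j + l + m) 1 by omega) hc
      rw [hbot, AddSubgroup.mem_bot] at hc0
      simp [hc0, twistedAvg_zero]
    by_cases h1 : i + l = 1 ∧ j + m = 1
    · obtain ⟨rfl, rfl⟩ | ⟨rfl, rfl⟩ : (i = 1 ∧ l = 0) ∨ (i = 0 ∧ l = 1) := by omega
      · obtain ⟨rfl, rfl⟩ | ⟨rfl, rfl⟩ : (j = 1 ∧ m = 0) ∨ (j = 0 ∧ m = 1) := by omega
        · simp [twistedAvg_zero]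
        · simp [twistedAvg_zero]
      · obtain ⟨rfl, rfl⟩ | ⟨rfl, rfl⟩ : (j = 1 ∧ m = 0) ∨ (j = 0 ∧ m = 1) := by omega
        · simp [twistedAvg_zero]
        · simp [twistedAvg_zero]
    -- Setting variables to 0 either keeps the monomial or kills it, so every term averages to 0.
    · have e : ∀ u : ℕ → ℕ → ℕ,
          (∀ s t, u s t = s ^ (i + l) * t ^ (j + m)) ∨ (∀ s t, u s t = 0) →
          twistedAvg p ζ (fun s => twistedAvg p ζ (fun t => u s t • c)) = 0 := by
        rintro u (hu | hu)
        · simp only [hu]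
          exact twistedAvg_pow_pow hζ hM (by omega) (by omega) (by omega) c
        · simp only [hu, zero_smul, twistedAvg_zero]
      have e1 := e (fun s t => s ^ i * t ^ j * 0 ^ l * 0 ^ m) (by
        rcases eq_or_ne l 0 with rfl | hu <;> rcases eq_or_ne m 0 with rfl | hv
        · exact Or.inl fun s t => by ring
        all_goals exact Or.inr fun s t => by simp [*])
      have e2 := e (fun s t => 0 ^ i * 0 ^ j * s ^ l * t ^ m) (by
        rcases eq_or_ne i 0 with rfl | hu <;> rcases eq_or_ne j 0 with rfl | hv
        · exact Or.inl fun s t => by ring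
        all_goals exact Or.inr fun s t => by simp [*])
      have e3 := e (fun s t => s ^ i * 0 ^ j * 0 ^ l * t ^ m) (by
        rcases eq_or_ne j 0 with rfl | hu <;> rcases eq_or_ne l 0 with rfl | hv
        · exact Or.inl fun s t => by ring
        all_goals exact Or.inr fun s t => by simp [*])
      have e4 := e (fun s t => 0 ^ i * t ^ j * s ^ l * 0 ^ m) (by
        rcases eq_or_ne i 0 with rfl | hu <;> rcases eq_or_ne m 0 with rfl | hv
        · exact Or.inl fun s t => by ring
        all_goals exact Or.inr fun s t => by simp [*])
      rw [e1, e2, e3, e4, e _ (Or.inl fun s t => by ring)]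
      simp

end Average

end LeftBrace

/-! ### The linear part and its pre-Lie identity -/

namespace LeftBrace

variable {A : Type*} [LeftBrace A]

/-- The linear part (up to the factor `p - 1`) of `a ↦ astHom a`, obtained by averaging. -/
def linHom (p ζ : ℕ) (a : A) : AddMonoid.End A := twistedAvg p ζ fun s => astHom (s • a)

theorem linHom_zero (p ζ : ℕ) : linHom p ζ (0 : A) = 0 := by
  simp [linHom, astHom_zero, twistedAvg_zero]

theorem linHom_apply (p ζ : ℕ) (a b : A) :
    linHom p ζ a b = twistedAvg p ζ fun s => astHom (s • a) b :=
  map_twistedAvg (evalEnd b) _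

theorem twistedAvg_mem {M : Type*} [AddCommGroup M] {H : AddSubgroup M} {p ζ : ℕ} {f : ℕ → M}
    (hf : ∀ s, f s ∈ H) : twistedAvg p ζ f ∈ H :=
  sum_mem fun _ _ => nsmul_mem (hf _) _

theorem linHom_mem {p k : ℕ} (hpow : IsIdeal (pMultiples A p k)) {a : A}
    (ha : a ∈ pMultiples A p k) (ζ : ℕ) (b : A) : linHom p ζ a b ∈ pMultiples A p k := by
  rw [linHom_apply]
  exact twistedAvg_mem fun s => (hpow _ (nsmul_mem ha s) b).1

theorem linHom_add {p n k ζ : ℕ} (hp : p.Prime) (hA : ∀ x : A, p ^ n • x = 0)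
    (hk : pMultiples A p (k * (p - 1)) = ⊥) (hpow : ∀ i, IsIdeal (pMultiples A p i))
    (hζ : p ≠ 2 → KillsPowers p n ζ)
    {a b : A} (ha : a ∈ pMultiples A p k) (hb : b ∈ pMultiples A p k) :
    linHom p ζ (a + b) = linHom p ζ a + linHom p ζ b := by
  -- The averaging property is only available for odd p; for p = 2 the hypothesis `hk` says p^k A =
  -- 0.
  by_cases hp2 : p = 2
  · subst hp2
    rw [show k * (2 - 1) = k by simp] at hk
    rw [hk, AddSubgroup.mem_bot] at ha hb
    simp [ha, hb, linHom_zero]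
  have hF := endMultiples_mul_antitone (A := A) p k
  have hf : (fun t : Fin 2 → ℕ => t 0 • a + t 1 • b) ∈
      polyMaps (Fin 2) (fun j => pMultiples A p (k * j)) 1 :=
    add_mem (coord_mem_polyMaps 0 (by simpa using ha)) (coord_mem_polyMaps 1 (by simpa using hb))
  have h := twistedAvg_diagonal hF (endMultiples_eq_bot hk) (hζ hp2)
    (fun φ => by ext x; exact hA (φ x)) (astHom_comp_mem_polyMaps hp hA hk hpow le_rfl hf)
  simpa [linHom, ← smul_add] using h

theorem linHom_nsmul {p n k ζ : ℕ} (hp : p.Prime) (hA : ∀ x : A, p ^ n • x = 0)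
    (hk : pMultiples A p (k * (p - 1)) = ⊥) (hpow : ∀ i, IsIdeal (pMultiples A p i))
    (hζ : p ≠ 2 → KillsPowers p n ζ)
    {a : A} (ha : a ∈ pMultiples A p k) (m : ℕ) :
    linHom p ζ (m • a) = m • linHom p ζ a := by
  induction m with
  | zero => simp [linHom_zero]
  | succ m ih =>
    rw [succ_nsmul, succ_nsmul, linHom_add hp hA hk hpow hζ (nsmul_mem ha m) ha, ih]

theorem linHom_twistedAvg {p n k ζ : ℕ} (hp : p.Prime) (hA : ∀ x : A, p ^ n • x = 0)
    (hk : pMultiples A p (k * (p - 1)) = ⊥) (hpow : ∀ i, IsIdeal (pMultiples A p i))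
    (hζ : p ≠ 2 → KillsPowers p n ζ)
    {f : ℕ → A} (hf : ∀ s, f s ∈ pMultiples A p k) :
    linHom p ζ (twistedAvg p ζ f) = twistedAvg p ζ fun s => linHom p ζ (f s) := by
  -- `linHom` is known to be additive only on p^k A, so the average is moved through its
  -- restriction.
  let Φ : pMultiples A p k →+ AddMonoid.End A :=
    AddMonoidHom.mk' (fun a => linHom p ζ (a : A))
      fun a b => linHom_add hp hA hk hpow hζ a.2 b.2
  have h := map_twistedAvg (p := p) (ζ := ζ) Φ fun s => ⟨f s, hf s⟩
  have h' := map_twistedAvg (p := p) (ζ := ζ) (pMultiples A p k).subtype fun s => ⟨f s, hf s⟩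
  simp only [AddSubgroup.subtype_apply] at h'
  rw [← h']
  exact h

/-- The part of bidegree `(1, 1)` of the identity `(1 + L_a) (1 + L_b) = 1 + L_{a ∘ b}`. -/
theorem linHom_mul_linHom {p n k ζ : ℕ} (hp : p.Prime) (hA : ∀ x : A, p ^ n • x = 0)
    (hk : pMultiples A p (k * (p - 1)) = ⊥) (hpow : ∀ i, IsIdeal (pMultiples A p i))
    (hζ : p ≠ 2 → KillsPowers p n ζ)
    {a b : A} (ha : a ∈ pMultiples A p k) (hb : b ∈ pMultiples A p k) :
    linHom p ζ a * linHom p ζ b =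
      twistedAvg p ζ (fun s => twistedAvg p ζ fun t => astHom (s • a + t • b)) +
        linHom p ζ (linHom p ζ a b) := by
  by_cases hp2 : p = 2
  · subst hp2
    rw [show k * (2 - 1) = k by simp] at hk
    rw [hk, AddSubgroup.mem_bot] at ha hb
    simp [ha, hb, linHom_zero, astHom_zero, twistedAvg_zero]
  have hF := endMultiples_mul_antitone (A := A) p k
  have hE : ∀ φ : AddMonoid.End A, p ^ n • φ = 0 := fun φ => by ext x; exact hA (φ x)
  have ha' : a ∈ pMultiples A p (k * 1) := by simpa using ha
  have hb' : b ∈ pMultiples A p (k * 1) := by simpa using hb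
  have hf : (fun t : Fin 4 → ℕ => t 0 • a + t 1 • b + astHom (t 2 • a) (t 3 • b)) ∈
      polyMaps (Fin 4) (fun j => pMultiples A p (k * j)) 1 :=
    add_mem (add_mem (coord_mem_polyMaps 0 ha') (coord_mem_polyMaps 1 hb'))
      (polyMaps_antitone (pMultiples_mul_antitone p k) (by omega)
        (apply_mem_polyMaps
          (astHom_comp_mem_polyMaps hp hA hk hpow le_rfl (coord_mem_polyMaps 2 ha'))
          (coord_mem_polyMaps 3 hb')))
  have h := twistedAvg_bidiagonal hF (endMultiples_eq_bot hk) (hζ hp2) hE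
    (astHom_comp_mem_polyMaps hp hA hk hpow le_rfl hf)
  have hconst : ∀ φ : AddMonoid.End A, twistedAvg p ζ (fun _ => φ) = 0 := fun φ => by
    have := hp.two_le
    have h0 := twistedAvg_pow (hζ hp2) hE (m := 0) (by omega) (by omega) φ
    simpa using h0
  have hleft : ∀ (φ : AddMonoid.End A) (f : ℕ → AddMonoid.End A),
      twistedAvg p ζ (fun t => φ * f t) =
      φ * twistedAvg p ζ (fun t => f t) :=
    fun φ f => (map_twistedAvg (AddMonoidHom.mulLeft φ) f).symm
  have hright : ∀ (φ : AddMonoid.End A) (f : ℕ → AddMonoid.End A),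
      twistedAvg p ζ (fun t => f t * φ) =
      twistedAvg p ζ (fun t => f t) * φ :=
    fun φ f => (map_twistedAvg (AddMonoidHom.mulRight φ) f).symm
  have hzero : ∀ x : A, astHom 0 x = 0 := fun x => by rw [astHom_zero]; rfl
  have h1 : twistedAvg p ζ (fun s => twistedAvg p ζ fun t =>
      astHom (s • a + t • b + astHom (s • a) (t • b))) = linHom p ζ a * linHom p ζ b := by
    simp only [← mul_eq, astHom_mul, twistedAvg_add, hconst, hleft, hright]
    simp [linHom]
  have h2 : twistedAvg p ζ (fun s => twistedAvg p ζ fun t =>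
      astHom (astHom (s • a) (t • b))) = linHom p ζ (linHom p ζ a b) := by
    rw [linHom_apply, linHom_twistedAvg hp hA hk hpow hζ (f := fun s => astHom (s • a) b)
      fun s => (hpow k _ (nsmul_mem ha s) b).1]
    simp only [linHom, map_nsmul]
  -- The two mixed terms are constant in t or in s, so they average to 0.
  simp only [Matrix.cons_val_zero, Matrix.cons_val_one, Matrix.cons_val, zero_smul, zero_add,
    add_zero, map_zero, hzero, h1, h2, hconst] at h
  exact h

/-- The pre-Lie identity for `(a, b) ↦ linHom a b`. -/
theorem linHom_linHom_sub {p n k ζ : ℕ} (hp : p.Prime) (hA : ∀ x : A, p ^ n • x = 0)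
    (hk : pMultiples A p (k * (p - 1)) = ⊥) (hpow : ∀ i, IsIdeal (pMultiples A p i))
    (hζ : p ≠ 2 → KillsPowers p n ζ)
    {a b : A} (ha : a ∈ pMultiples A p k) (hb : b ∈ pMultiples A p k) :
    linHom p ζ (linHom p ζ a b) - linHom p ζ a * linHom p ζ b =
      linHom p ζ (linHom p ζ b a) - linHom p ζ b * linHom p ζ a := by
  rw [linHom_mul_linHom hp hA hk hpow hζ ha hb, linHom_mul_linHom hp hA hk hpow hζ hb ha,
    twistedAvg_comm]
  simp only [add_comm (_ • b) (_ • a)]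
  abel

end LeftBrace

/-! ### Roots of unity modulo p^n -/

/-- A primitive root modulo `p ^ n` gives a root of unity of order `p - 1` modulo `p ^ n`. -/
theorem IsPrimitiveRootModulo.killsPowers {p n : ℕ} (hp : p.Prime) (hp2 : p ≠ 2) {γ : ℤ}
    (hγ : IsPrimitiveRootModulo γ (p ^ n)) {ζ : ℕ}
    (hζ : (ζ : ℤ) ≡ γ ^ p ^ (n - 1) [ZMOD (p ^ n : ℕ)]) : LeftBrace.KillsPowers p n ζ := by
  intro m hm hm1
  rcases Nat.eq_zero_or_pos n with rfl | hn
  · simp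
  have hp3 : 2 < p := lt_of_le_of_ne hp.two_le (Ne.symm hp2)
  have := Fact.mk hp
  have hpn : (p : ℤ) ∣ ((p ^ n : ℕ) : ℤ) := by
    exact_mod_cast dvd_pow_self p hn.ne'
  have hζp : (ζ : ZMod p) = (γ : ZMod p) := by
    have h := (ZMod.intCast_eq_intCast_iff _ _ _).2 (hζ.of_dvd hpn)
    push_cast at h
    rw [h, ZMod.pow_card_pow]
  have hgen : ∀ a : ZMod p, a ≠ 0 → ∃ j : ℕ, a = (ζ : ZMod p) ^ j := by
    intro a ha
    have hcop : IsCoprime (a.val : ℤ) ((p ^ n : ℕ) : ℤ) := by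
      rw [Nat.isCoprime_iff_coprime]
      refine Nat.Coprime.pow_right _ (Nat.Coprime.symm ((hp.coprime_iff_not_dvd).2 fun h => ha ?_))
      rw [← ZMod.natCast_zmod_val a]
      exact (ZMod.natCast_eq_zero_iff _ _).2 h
    obtain ⟨j, hj⟩ := hγ _ hcop
    refine ⟨j, ?_⟩
    have h := (ZMod.intCast_eq_intCast_iff _ _ _).2 (hj.of_dvd hpn)
    push_cast at h
    rw [ZMod.natCast_zmod_val] at h
    rw [h, hζp]
  have hζ0 : (ζ : ZMod p) ≠ 0 := by
    intro h0
    obtain ⟨j, hj⟩ := hgen (-1) (by simp)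
    have : Fact (2 < p) := ⟨hp3⟩
    rcases Nat.eq_zero_or_pos j with rfl | hj'
    · exact ZMod.neg_one_ne_one (by simpa using hj)
    · rw [h0, zero_pow hj'.ne'] at hj
      simp at hj
  -- ζ ≡ γ modulo p generates the units modulo p, so its order there is exactly p - 1.
  have hne : ∀ j, 0 < j → j < p - 1 → (ζ : ZMod p) ^ j ≠ 1 := by
    intro j hj0 hj h1
    have hu : ∀ u : (ZMod p)ˣ, u ∈ Subgroup.zpowers (Units.mk0 _ hζ0) := by
      intro u
      obtain ⟨i, hi⟩ := hgen u u.ne_zero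
      exact ⟨i, by ext; simp [hi]⟩
    have hord := orderOf_eq_card_of_forall_mem_zpowers hu
    rw [Nat.card_eq_fintype_card, ZMod.card_units] at hord
    have hdvd : p - 1 ∣ j := hord ▸ orderOf_dvd_of_pow_eq_one (by ext; simpa using h1)
    exact absurd (Nat.le_of_dvd hj0 hdvd) (by omega)
  have hcopζ : IsCoprime γ ((p ^ n : ℕ) : ℤ) := by
    rw [Nat.cast_pow]
    refine IsCoprime.pow_right (IsCoprime.symm ((Nat.prime_iff_prime_int.1 hp).coprime_iff_not_dvd.2
      fun h => hζ0 ?_))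
    rw [hζp]
    exact (ZMod.intCast_zmod_eq_zero_iff_dvd _ _).2 h
  have hone : (ζ : ZMod (p ^ n)) ^ (p - 1) = 1 := by
    have h := (ZMod.intCast_eq_intCast_iff _ _ _).2 hζ
    push_cast at h
    have hu := ZMod.pow_totient (n := p ^ n) (ZMod.unitOfIsCoprime γ hcopζ)
    rw [Nat.totient_prime_pow hp hn] at hu
    have hu' := congrArg Units.val hu
    rw [h, ← pow_mul]
    simpa using hu'
  rw [← ZMod.natCast_eq_zero_iff]
  push_cast
  have geom : ∀ j, 0 < j → j < p - 1 →
      ∑ r ∈ Finset.range (p - 1), ((ζ : ZMod (p ^ n)) ^ j) ^ r = 0 := by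
    intro j hj0 hj
    have h := mul_neg_geom_sum ((ζ : ZMod (p ^ n)) ^ j) (p - 1)
    rw [← pow_mul, mul_comm j, pow_mul, hone, one_pow, sub_self] at h
    -- Nonzero modulo p means invertible modulo p^n, so the geometric sum itself vanishes.
    have hunit : IsUnit (1 - (ζ : ZMod (p ^ n)) ^ j) := by
      have hc : IsCoprime (1 - (ζ : ℤ) ^ j) ((p ^ n : ℕ) : ℤ) := by
        rw [Nat.cast_pow]
        refine IsCoprime.pow_right (IsCoprime.symm
          ((Nat.prime_iff_prime_int.1 hp).coprime_iff_not_dvd.2 fun h => hne j hj0 hj ?_))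
        have h' := (ZMod.intCast_zmod_eq_zero_iff_dvd _ _).2 h
        push_cast at h'
        exact (sub_eq_zero.1 h').symm
      obtain ⟨u, v, huv⟩ := hc
      have huv' := congrArg (Int.cast : ℤ → ZMod (p ^ n)) huv
      rw [Int.cast_add, Int.cast_mul, Int.cast_mul, Int.cast_natCast, ZMod.natCast_self, mul_zero,
        add_zero] at huv'
      push_cast at huv'
      exact IsUnit.of_mul_eq_one_right _ huv'
    exact hunit.mul_right_eq_zero.1 h
  rcases Nat.eq_zero_or_pos m with rfl | hm0
  · simp only [pow_zero, mul_one]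
    rw [← Finset.sum_range_reflect]
    have h := geom 1 one_pos (by omega)
    rw [pow_one] at h
    rw [← mul_zero (ζ : ZMod (p ^ n)), ← h, Finset.mul_sum]
    refine Finset.sum_congr rfl fun r hr => ?_
    have := Finset.mem_range.1 hr
    rw [← pow_succ', show p - 1 - (p - 1 - 1 - r) = r + 1 by omega]
  · have h := geom (m - 1) (by omega) (by omega)
    rw [← mul_zero ((ζ : ZMod (p ^ n)) ^ (p - 1)), ← h, Finset.mul_sum]
    refine Finset.sum_congr rfl fun r hr => ?_
    have := Finset.mem_range.1 hr
    obtain ⟨m, rfl⟩ := Nat.exists_eq_add_of_lt hm0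
    simp only [zero_add, Nat.add_sub_cancel]
    rw [← pow_mul, ← pow_mul, ← pow_add, ← pow_add]
    congr 1
    have : p - 1 = (p - 1 - r) + r := by omega
    nlinarith

theorem IsPreLieRing.of_biadditive {M : Type*} [inst : AddCommGroup M] {mul : M → M → M}
    (add_left : ∀ x y z, mul (x + y) z = mul x z + mul y z)
    (add_right : ∀ x y z, mul x (y + z) = mul x y + mul x z)
    (assoc_symm : ∀ x y z, mul (mul x y) z - mul x (mul y z) = mul (mul y x) z - mul y (mul x z)) :
    IsPreLieRing mul :=
  ⟨{ inst with
      mul := mul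
      left_distrib := add_right
      right_distrib := add_left
      zero_mul := fun x => by
        have h := add_left 0 0 x
        rw [add_zero] at h
        exact left_eq_add.1 h
      mul_zero := fun x => by
        have h := add_right x 0 0
        rw [add_zero] at h
        exact left_eq_add.1 h
      assoc_symm' := assoc_symm }, rfl, fun _ _ => rfl⟩

/-! ### Descent to A/ann(p^(2k)) -/

namespace LeftBrace

variable {A : Type*} [LeftBrace A]

/-- Congruence modulo I gives a = a' ∘ x with x in I, and then L_a - L_{a'} = L_x + L_{a'} L_x. -/
theorem astHom_sub_astHom_mem {I : AddSubgroup A} (hI : IsIdeal I) {a a' : A} (h : a - a' ∈ I)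
    (y : A) : astHom a y - astHom a' y ∈ I := by
  have hx : a'⁻¹ * a ∈ I := by
    rw [inv_mul_eq]
    exact add_mem h (hI _ h _).2
  have h1 := astHom_mul a' (a'⁻¹ * a)
  rw [mul_inv_cancel_left] at h1
  have h2 : astHom a y - astHom a' y =
      astHom (a'⁻¹ * a) y + astHom a' (astHom (a'⁻¹ * a) y) := by
    rw [h1]
    change astHom a' y + astHom (a'⁻¹ * a) y + astHom a' (astHom (a'⁻¹ * a) y) - astHom a' y = _
    abel
  rw [h2]
  have h3 := (hI _ hx y).1
  exact add_mem h3 (hI _ h3 _).2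

/-- `p ^ k ((p ^ k x) ∗ y)` depends only on the classes of `x` and `y` modulo `ann(p ^ (2 k))`. -/
theorem nsmul_ast_congr {p k : ℕ} (hann : IsIdeal (ann A p k))
    (hsub : ∀ a ∈ pMultiples A p k, ∀ b ∈ ann A p (2 * k), ast a b ∈ ann A p k)
    {x x' y y' : A} (hx : x - x' ∈ ann A p (2 * k)) (hy : y - y' ∈ ann A p (2 * k)) :
    p ^ k • ast (p ^ k • x) y = p ^ k • ast (p ^ k • x') y' := by
  have h1 : p ^ k • (astHom (p ^ k • x) y - astHom (p ^ k • x') y) = 0 := by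
    refine astHom_sub_astHom_mem hann ?_ y
    rw [mem_ann] at hx ⊢
    rwa [← smul_sub, smul_smul, ← pow_add, ← two_mul]
  have h2 : p ^ k • astHom (p ^ k • x') (y - y') = 0 := hsub _ ⟨x', rfl⟩ _ hy
  rw [smul_sub, sub_eq_zero] at h1
  rw [map_sub, smul_sub, sub_eq_zero] at h2
  exact h1.trans h2

/-- If `p ^ k v` and `d ∈ p ^ k A` differ by an element of `ann(p ^ k)`, then `linHom a` agrees on
them. -/
theorem linHom_congr {p k ζ : ℕ}
    (hsub : ∀ a ∈ pMultiples A p k, ∀ b ∈ ann A p (2 * k), ast a b ∈ ann A p k)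
    {a d v : A} (ha : a ∈ pMultiples A p k) (hd : d ∈ pMultiples A p k)
    (h : p ^ (2 * k) • v = p ^ k • d) : p ^ k • linHom p ζ a v = linHom p ζ a d := by
  obtain ⟨d, rfl⟩ := hd
  change p ^ k • linHom p ζ a v = linHom p ζ a (p ^ k • d)
  change p ^ (2 * k) • v = p ^ k • p ^ k • d at h
  rw [map_nsmul, ← sub_eq_zero, ← smul_sub, ← map_sub, linHom_apply]
  refine twistedAvg_mem (H := ann A p k) fun s => hsub _ (nsmul_mem ha s) _ ?_
  rw [mem_ann, smul_sub, h, smul_smul, ← pow_add, ← two_mul, sub_self]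

end LeftBrace

open LeftBrace in
theorem mainTheorem3 {A : Type*} [LeftBrace A] (p n k : ℕ) (hp : p.Prime)
    (hcard : Nat.card A = p ^ n)
    (hk : LeftBrace.pMultiples A p (k * (p - 1)) = ⊥)
    (hpow : ∀ i : ℕ, LeftBrace.IsIdeal (LeftBrace.pMultiples A p i))
    (hann : ∀ i : ℕ, LeftBrace.IsIdeal (LeftBrace.ann A p i))
    (hsub : ∀ a ∈ LeftBrace.pMultiples A p k, ∀ b ∈ LeftBrace.ann A p (2 * k),
      LeftBrace.ast a b ∈ LeftBrace.ann A p k)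
    -- the pullback `℘⁻¹ : p ^ k A → A`, an arbitrary choice of `p ^ k`-th parts
    (pullback : LeftBrace.pMultiples A p k → A)
    (hpullback : ∀ a : LeftBrace.pMultiples A p k, p ^ k • pullback a = (a : A))
    (γ ξ : ℤ) (hγ : IsPrimitiveRootModulo γ (p ^ n)) (hξ : ξ = γ ^ p ^ (n - 1)) :
    ∃ odot : A ⧸ LeftBrace.ann A p (2 * k) → A ⧸ LeftBrace.ann A p (2 * k) →
        A ⧸ LeftBrace.ann A p (2 * k),
      (∀ x y : A, odot (QuotientAddGroup.mk x) (QuotientAddGroup.mk y) =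
        QuotientAddGroup.mk
          (pullback ⟨LeftBrace.ast (p ^ k • x) y, (hpow k _ ⟨x, rfl⟩ y).1⟩)) ∧
      ∃ bullet : A ⧸ LeftBrace.ann A p (2 * k) → A ⧸ LeftBrace.ann A p (2 * k) →
          A ⧸ LeftBrace.ann A p (2 * k),
        (∀ x y : A, bullet (QuotientAddGroup.mk x) (QuotientAddGroup.mk y) =
          ∑ i ∈ Finset.range (p - 1),
            ξ ^ (p - 1 - i) • odot (QuotientAddGroup.mk (ξ ^ i • x)) (QuotientAddGroup.mk y)) ∧
        IsPreLieRing bullet := by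
  have hA : ∀ x : A, p ^ n • x = 0 := fun x => by rw [← hcard]; exact card_nsmul_eq_zero'
  -- Polynomial maps are evaluated at natural numbers, so ξ is replaced by a natural representative
  -- modulo p^n.
  obtain ⟨ζ, hζ⟩ : ∃ ζ : ℕ, (ζ : ℤ) ≡ ξ [ZMOD (p ^ n : ℕ)] :=
    ⟨(ξ % (p ^ n : ℕ)).toNat, by
      rw [Int.toNat_of_nonneg (Int.emod_nonneg _ (by exact_mod_cast (pow_pos hp.pos n).ne'))]
      exact Int.mod_modEq _ _⟩
  have hkill : p ≠ 2 → KillsPowers p n ζ := fun hp2 => hγ.killsPowers hp hp2 (hξ ▸ hζ)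
  have hξζ : ∀ (i : ℕ) (x : A), ξ ^ i • x = ζ ^ i • x := fun i x => by
    obtain ⟨c, hc⟩ := (hζ.pow i).dvd
    rw [← natCast_zsmul x (ζ ^ i), ← sub_eq_zero, ← sub_smul, Nat.cast_pow, hc, mul_comm,
      mul_smul, natCast_zsmul, hA, smul_zero]
  -- All identities are checked in A after multiplication by p^(2k), which is injective on the
  -- quotient.
  let Φ : A ⧸ ann A p (2 * k) →+ A :=
    QuotientAddGroup.kerLift (nsmulAddMonoidHom (α := A) (p ^ (2 * k)))
  have hΦ : Function.Injective Φ := QuotientAddGroup.kerLift_injective _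
  have hΦmk : ∀ x : A, Φ (QuotientAddGroup.mk x) = p ^ (2 * k) • x := fun _ => rfl
  have hpull : ∀ a, p ^ (2 * k) • pullback a = p ^ k • (a : A) := fun a => by
    rw [two_mul, pow_add, mul_smul, hpullback]
  let odot : A ⧸ ann A p (2 * k) → A ⧸ ann A p (2 * k) → A ⧸ ann A p (2 * k) := fun X Y =>
    QuotientAddGroup.mk (pullback ⟨ast (p ^ k • X.out) Y.out, (hpow k _ ⟨X.out, rfl⟩ Y.out).1⟩)
  have hout : ∀ x : A, (QuotientAddGroup.mk x : A ⧸ ann A p (2 * k)).out - x ∈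
      ann A p (2 * k) := fun x => by
    rw [mem_ann, smul_sub, sub_eq_zero, ← hΦmk, ← hΦmk, QuotientAddGroup.out_eq']
  have hodot : ∀ x y : A, Φ (odot (QuotientAddGroup.mk x) (QuotientAddGroup.mk y)) =
      p ^ k • ast (p ^ k • x) y := fun x y => by
    rw [hΦmk, hpull]
    exact nsmul_ast_congr (hann k) hsub (hout x) (hout y)
  refine ⟨odot, fun x y => hΦ ?_, fun X Y => ∑ i ∈ Finset.range (p - 1),
    ξ ^ (p - 1 - i) • odot (ξ ^ i • X) Y, fun x y => rfl, ?_⟩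
  · rw [hodot, hΦmk, hpull]
  have hbullet : ∀ x y : A, Φ (∑ i ∈ Finset.range (p - 1),
      ξ ^ (p - 1 - i) • odot (ξ ^ i • QuotientAddGroup.mk x) (QuotientAddGroup.mk y)) =
      p ^ k • linHom p ζ (p ^ k • x) y := fun x y => by
    rw [map_sum, linHom_apply, twistedAvg, Finset.smul_sum]
    refine Finset.sum_congr rfl fun i _ => ?_
    rw [map_zsmul, hξζ, ← QuotientAddGroup.mk_zsmul, hodot, hξζ, astHom_apply,
      smul_comm (p ^ k) (ζ ^ i), smul_comm (p ^ k) (ζ ^ (p - 1 - i))]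
  have hI : ∀ x : A, p ^ k • x ∈ pMultiples A p k := fun x => ⟨x, rfl⟩
  refine IsPreLieRing.of_biadditive ?_ ?_ ?_
  · intro X Y Z
    induction X using QuotientAddGroup.induction_on with | H x
    induction Y using QuotientAddGroup.induction_on with | H y
    induction Z using QuotientAddGroup.induction_on with | H z
    apply hΦ
    rw [← QuotientAddGroup.mk_add, map_add, hbullet, hbullet, hbullet, smul_add,
      linHom_add hp hA hk hpow hkill (hI x) (hI y), ← smul_add]
    rfl
  · intro X Y Z
    induction X using QuotientAddGroup.induction_on with | H x
    induction Y using QuotientAddGroup.induction_on with | H y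
    induction Z using QuotientAddGroup.induction_on with | H z
    apply hΦ
    rw [← QuotientAddGroup.mk_add, map_add, hbullet, hbullet, hbullet, map_add, smul_add]
  -- Under Φ the associator becomes that of `linHom` at p^k x and p^k y, up to sign and applied to
  -- z; no division by p remains.
  · have hassoc : ∀ x y z : A, Φ
        ((∑ i ∈ Finset.range (p - 1), ξ ^ (p - 1 - i) • odot (ξ ^ i • ∑ j ∈ Finset.range (p - 1),
          ξ ^ (p - 1 - j) • odot (ξ ^ j • QuotientAddGroup.mk x) (QuotientAddGroup.mk y))
            (QuotientAddGroup.mk z)) -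
        ∑ i ∈ Finset.range (p - 1), ξ ^ (p - 1 - i) • odot (ξ ^ i • QuotientAddGroup.mk x)
          (∑ j ∈ Finset.range (p - 1), ξ ^ (p - 1 - j) • odot (ξ ^ j • QuotientAddGroup.mk y)
            (QuotientAddGroup.mk z))) =
        (linHom p ζ (linHom p ζ (p ^ k • x) (p ^ k • y)) -
          linHom p ζ (p ^ k • x) * linHom p ζ (p ^ k • y)) z := by
      intro x y z
      have hxy := hbullet x y
      have hyz := hbullet y z
      generalize (∑ j ∈ Finset.range (p - 1), ξ ^ (p - 1 - j) •
        odot (ξ ^ j • QuotientAddGroup.mk x) (QuotientAddGroup.mk y)) = W at hxy ⊢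
      generalize (∑ j ∈ Finset.range (p - 1), ξ ^ (p - 1 - j) •
        odot (ξ ^ j • QuotientAddGroup.mk y) (QuotientAddGroup.mk z)) = V at hyz ⊢
      induction W using QuotientAddGroup.induction_on with | H w
      induction V using QuotientAddGroup.induction_on with | H v
      rw [hΦmk] at hxy hyz
      rw [map_sub, hbullet, hbullet,
        linHom_congr hsub (hI x) (linHom_mem (hpow k) (hI y) ζ z) hyz, map_nsmul _ (p ^ k) y,
        ← hxy, two_mul, pow_add, mul_smul, linHom_nsmul hp hA hk hpow hkill (hI w)]
      rfl
    intro X Y Z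
    induction X using QuotientAddGroup.induction_on with | H x
    induction Y using QuotientAddGroup.induction_on with | H y
    induction Z using QuotientAddGroup.induction_on with | H z
    apply hΦ
    rw [hassoc, hassoc, linHom_linHom_sub hp hA hk hpow hkill (hI x) (hI y)]
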